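/- All maps are continuous. For metrizable spaces $X$ and $Y$, the set $C(X,Y)$ of all maps $X\to Y$ carries the limitation topology: a neighbourhood base at $f\in C(X,Y)$ is given by the sets $B(f,\mathcal U)=\{g\in C(X,Y):\ \forall x\in X\ \exists U\in\mathcal U,\ \{f(x),g(x)\}\subset U\}$, where $\mathcal U$ runs over all open covers of $Y$. A metrizable space $P$ is an ANR (absolute neighbourhood retract) if, whenever $P$ is embedded as a closed subset of a metrizable space $Z$, it is a retract of an open neighbourhood of itself in $Z$. Let $X$ be a metrizable space, let $(Y,\varrho)$ be a metric space, and let $P\subset Y$ be a subset which, with the subspace topology, is a completely metrizable ANR. Let $A,A_1,A_2,A_3,\ldots$ be closed subsets of $X$ such that $A\cap A_n=\varnothing\neq A_n$ for every $n$. For every $n$ let $G_n$ be a dense $G_\delta$ subset of $C(A_n,P)$, and let $\lambda\colon X\setminus A\to(0,\infty)$ be a map with $\inf\lambda(A_n)>0$ for every $n$. Then for every map $f\colon X\to Y$ with $f(X\setminus A)\subset P$ and every neighbourhood $G$ of $f|_{X\setminus A}$ in $C(X\setminus A,P)$ there is a map $h\colon X\to Y$ such that \begin{enumerate} \item $h|_A=f|_A$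 and $h(X\setminus A)\subset P$; \item $h|_{A_n}\in G_n$ for every $n$; \item $h|_{X\setminus A}\in G$ and $\varrho(h(x),f(x))<\lambda(x)$ for every $x\in X\setminus A$. \end{enumerate} -/

import Mathlib

open Set Topology

universe u v

/-- A metrizable space `P` is an absolute neighbourhood retract (for metrizable spaces): whenever it
is embedded as a closed subset of a metrizable space `Z`, it is a retract of an open neighbourhood
of (the image of) `P` in `Z`.  The retraction `r` is written as a map to `P`, with `r (e p) = p`. -/
def IsANR (P : Type v) [TopologicalSpace P] : Prop :=
  TopologicalSpace.MetrizableSpace P ∧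
    ∀ (Z : Type v) [TopologicalSpace Z] [TopologicalSpace.MetrizableSpace Z] (e : P → Z),
      IsClosedEmbedding e →
        ∃ U : Set Z, IsOpen U ∧ range e ⊆ U ∧
          ∃ r : C(U, P), ∀ (p : P) (hp : e p ∈ U), r ⟨e p, hp⟩ = p

/-- `𝒰` is an open cover of `Y`. -/
def IsOpenCovering {Y : Type v} [TopologicalSpace Y] (𝒰 : Set (Set Y)) : Prop :=
  (∀ U ∈ 𝒰, IsOpen U) ∧ ⋃₀ 𝒰 = univ

/-- `B(f, 𝒰)`: the set of all maps that are `𝒰`-close to `f`. -/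
def coverBall {X : Type u} {Y : Type v} [TopologicalSpace X] [TopologicalSpace Y]
    (f : C(X, Y)) (𝒰 : Set (Set Y)) : Set C(X, Y) :=
  {g | ∀ x, ∃ U ∈ 𝒰, f x ∈ U ∧ g x ∈ U}

/-- The limitation topology on `C(X, Y)`: a set is open iff together with each map `f` it contains
`B(f, 𝒰)` for some open cover `𝒰` of `Y`.  For metrizable `Y` the sets `B(f, 𝒰)` form a
neighbourhood base at `f`, see `mem_nhds_limitationTopology`. -/
@[reducible]
def limitationTopology (X : Type u) (Y : Type v) [TopologicalSpace X] [TopologicalSpace Y] :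
    TopologicalSpace C(X, Y) where
  IsOpen O := ∀ f ∈ O, ∃ 𝒰 : Set (Set Y), IsOpenCovering 𝒰 ∧ coverBall f 𝒰 ⊆ O
  isOpen_univ := fun _ _ => ⟨{univ}, ⟨by simp, by simp⟩, subset_univ _⟩
  isOpen_inter := by
    rintro s t hs ht f ⟨hfs, hft⟩
    obtain ⟨𝒰, ⟨hU, hU'⟩, hUs⟩ := hs f hfs
    obtain ⟨𝒱, ⟨hV, hV'⟩, hVt⟩ := ht f hft
    refine ⟨{W | ∃ U ∈ 𝒰, ∃ V ∈ 𝒱, W = U ∩ V}, ⟨?_, ?_⟩, ?_⟩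
    · rintro _ ⟨U, h1, V, h2, rfl⟩
      exact (hU U h1).inter (hV V h2)
    · refine eq_univ_of_forall fun y => ?_
      obtain ⟨U, h1, h1'⟩ : y ∈ ⋃₀ 𝒰 := hU' ▸ mem_univ y
      obtain ⟨V, h2, h2'⟩ : y ∈ ⋃₀ 𝒱 := hV' ▸ mem_univ y
      exact ⟨U ∩ V, ⟨U, h1, V, h2, rfl⟩, h1', h2'⟩
    · intro g hg
      refine ⟨hUs fun x => ?_, hVt fun x => ?_⟩
      · obtain ⟨_, ⟨U, h1, V, h2, rfl⟩, h3, h4⟩ := hg x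
        exact ⟨U, h1, h3.1, h4.1⟩
      · obtain ⟨_, ⟨U, h1, V, h2, rfl⟩, h3, h4⟩ := hg x
        exact ⟨V, h2, h3.2, h4.2⟩
  isOpen_sUnion := by
    rintro S hS f ⟨s, hs, hfs⟩
    obtain ⟨𝒰, hU, hUs⟩ := hS s hs f hfs
    exact ⟨𝒰, hU, hUs.trans (subset_sUnion_of_mem hs)⟩

/-- The sets `B(f, 𝒰)`, with `𝒰` an open cover, form a neighbourhood base at `f`. -/
theorem mem_nhds_limitationTopology {X : Type u} {Y : Type v} [TopologicalSpace X]
    [TopologicalSpace Y] [TopologicalSpace.MetrizableSpace Y] (f : C(X, Y)) (S : Set C(X, Y)) :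
    S ∈ @nhds _ (limitationTopology X Y) f ↔
      ∃ 𝒰 : Set (Set Y), IsOpenCovering 𝒰 ∧ coverBall f 𝒰 ⊆ S := by
  let _ : MetricSpace Y := TopologicalSpace.metrizableSpaceMetric Y
  have self : ∀ (k : C(X, Y)) (𝒰 : Set (Set Y)), IsOpenCovering 𝒰 → k ∈ coverBall k 𝒰 := by
    intro k 𝒰 hU x
    obtain ⟨U, h1, h2⟩ : k x ∈ ⋃₀ 𝒰 := hU.2 ▸ mem_univ _
    exact ⟨U, h1, h2, h2⟩
  refine (@mem_nhds_iff _ (limitationTopology X Y) f S).trans ?_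
  constructor
  · rintro ⟨O, hOS, hO, hf⟩
    obtain ⟨𝒰, hU, h⟩ := hO f hf
    exact ⟨𝒰, hU, h.trans hOS⟩
  · rintro h
    refine ⟨{g | ∃ 𝒰 : Set (Set Y), IsOpenCovering 𝒰 ∧ coverBall g 𝒰 ⊆ S}, ?_, ?_, h⟩
    · rintro g ⟨𝒰, hU, hg⟩
      exact hg (self g 𝒰 hU)
    · rintro g ⟨𝒰, hU, hg⟩
      let 𝒱 : Set (Set Y) :=
        {V | ∃ (y : Y) (ε : ℝ), 0 < ε ∧ (∃ U ∈ 𝒰, Metric.ball y ε ⊆ U) ∧ V = Metric.ball y (ε / 4)}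
      have hV : IsOpenCovering 𝒱 := by
        refine ⟨?_, eq_univ_of_forall fun y => ?_⟩
        · rintro _ ⟨y, ε, -, -, rfl⟩
          exact Metric.isOpen_ball
        · obtain ⟨U, h1, h2⟩ : y ∈ ⋃₀ 𝒰 := hU.2 ▸ mem_univ y
          obtain ⟨ε, hε, h3⟩ := Metric.isOpen_iff.1 (hU.1 U h1) y h2
          exact ⟨_, ⟨y, ε, hε, ⟨U, h1, h3⟩, rfl⟩, Metric.mem_ball_self (by positivity)⟩
      refine ⟨𝒱, hV, fun k hk => ⟨𝒱, hV, fun l hl => hg fun x => ?_⟩⟩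
      obtain ⟨_, ⟨y, ε, hε, ⟨U, hU1, hU2⟩, rfl⟩, h1, h2⟩ := hk x
      obtain ⟨_, ⟨z, δ, hδ, ⟨W, hW1, hW2⟩, rfl⟩, h3, h4⟩ := hl x
      rw [Metric.mem_ball] at h1 h2 h3 h4
      rcases le_total δ ε with hle | hle
      · refine ⟨U, hU1, hU2 ?_, hU2 ?_⟩ <;> rw [Metric.mem_ball]
        · linarith
        · linarith [dist_triangle (l x) z y, dist_triangle z (k x) y, dist_comm (k x) z]
      · refine ⟨W, hW1, hW2 ?_, hW2 ?_⟩ <;> rw [Metric.mem_ball]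
        · linarith [dist_triangle (g x) y z, dist_triangle y (k x) z, dist_comm (k x) y]
        · linarith

/-- The restriction of a map `g : X → Y` to a map `S → P`, where `g(S) ⊆ P`. -/
def restrictTo {X : Type u} {Y : Type v} [TopologicalSpace X] [TopologicalSpace Y]
    (g : C(X, Y)) (S : Set X) (P : Set Y) (hg : MapsTo g S P) : C(S, P) :=
  ⟨hg.restrict g S P, g.continuous.restrict hg⟩

/-!
In the limitation topology a neighbourhood of a map `h` into a metric space `P` amounts to a gauge:
a positive `1`-Lipschitz function `η` on `P`, with `k` close to `h` when
`dist (h z) (k z) < η (h z)`.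

A completely metrizable ANR is a neighbourhood retract of a Banach space `E`. Hence a map `g` on a
closed set `K` that is close to the restriction of `h` extends to a map close to `h`: extend `g` to
a map into `E`, move along straight lines from `h` towards this extension near `K` and not at all
far from `K`, and retract. If `O` is dense and open in `C(K, P)`, the maps whose restriction to `K`
lies in `O` therefore have dense interior, and they are reached by moves much smaller than `lam`,
because `lam` is bounded below by a positive constant on `K` and the moves are confined to the
region where `lam` is not much smaller. Baire's argument, for a complete metric of `P` and with
halving gauges, produces a map near `f` satisfying all of the countably many conditions at once.

Replacing `lam` by its minimum with a function vanishing exactly on `A` and bounded away from `0` on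
each `A_n` makes the new map glue continuously with `f` on `A`.
-/

open Filter

/-- The neighbourhood filter of `f` in the limitation topology. It gets a name of its own because
the instance on `C(X, Y)`, to which `𝓝 f` refers, is the compact-open topology. -/
abbrev limitationNhds {X : Type u} {Y : Type v} [TopologicalSpace X] [TopologicalSpace Y]
    (f : C(X, Y)) : Filter C(X, Y) :=
  @nhds _ (limitationTopology X Y) f

section LimitationTopology

variable {Z : Type*} {P : Type*} [TopologicalSpace Z]

theorem limitationNhds_hasBasis_diagonal [TopologicalSpace P]
    [TopologicalSpace.MetrizableSpace P] (h : C(Z, P)) :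
    (limitationNhds h).HasBasis (fun M : Set (P × P) => IsOpen M ∧ ∀ p, (p, p) ∈ M)
      fun M => {k | ∀ z, (h z, k z) ∈ M} := by
  refine ⟨fun S => (mem_nhds_limitationTopology h S).trans ⟨?_, ?_⟩⟩
  · rintro ⟨𝒰, ⟨h𝒰, hcover⟩, hS⟩
    refine ⟨⋃ U ∈ 𝒰, U ×ˢ U, ⟨isOpen_biUnion fun U hU => (h𝒰 U hU).prod (h𝒰 U hU), ?_⟩,
      fun k hk => hS fun z => ?_⟩
    · intro p
      obtain ⟨U, hU, hpU⟩ : p ∈ ⋃₀ 𝒰 := hcover ▸ mem_univ p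
      exact mem_biUnion hU ⟨hpU, hpU⟩
    · obtain ⟨U, hU, hUz⟩ := mem_iUnion₂.1 (hk z)
      exact ⟨U, hU, hUz⟩
  · rintro ⟨M, ⟨hM, hdiag⟩, hS⟩
    refine ⟨{V | IsOpen V ∧ V ×ˢ V ⊆ M}, ⟨fun V hV => hV.1, eq_univ_of_forall fun p => ?_⟩,
      fun k hk => hS fun z => ?_⟩
    · obtain ⟨V, hV, hpV, hVM⟩ := exists_nhds_square (hM.mem_nhds (hdiag p))
      exact ⟨V, ⟨hV, hVM⟩, hpV⟩
    · obtain ⟨V, ⟨-, hVM⟩, hh, hk⟩ := hk z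
      exact hVM ⟨hh, hk⟩

theorem continuous_comp_limitationTopology [TopologicalSpace P] {B : Type*} [TopologicalSpace B]
    (e : C(B, Z)) :
    @Continuous _ _ (limitationTopology Z P) (limitationTopology B P)
      fun k : C(Z, P) => k.comp e := by
  let _ := limitationTopology Z P
  let _ := limitationTopology B P
  refine continuous_def.2 fun O hO k hk => ?_
  obtain ⟨𝒰, h𝒰, hball⟩ := hO (k.comp e) hk
  exact ⟨𝒰, h𝒰, fun g hg => hball fun b => hg (e b)⟩

/-- A gauge on a metric space is a positive `1`-Lipschitz function: it bounds how far a map may be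
moved at a point, and being Lipschitz, the bound changes in a controlled way under the move. -/
structure IsGauge [PseudoMetricSpace P] (η : P → ℝ) : Prop where
  pos : ∀ p, 0 < η p
  lipschitz : LipschitzWith 1 η

theorem IsGauge.le_add_dist [PseudoMetricSpace P] {η : P → ℝ} (hη : IsGauge η) (p q : P) :
    η p ≤ η q + dist p q := by
  simpa using hη.lipschitz.le_add_mul p q

theorem IsGauge.const [PseudoMetricSpace P] {c : ℝ} (hc : 0 < c) : IsGauge fun _ : P => c :=
  ⟨fun _ => hc, .const' c⟩

theorem IsGauge.min [PseudoMetricSpace P] {η θ : P → ℝ} (hη : IsGauge η) (hθ : IsGauge θ) :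
    IsGauge fun p => min (η p) (θ p) :=
  ⟨fun p => lt_min (hη.pos p) (hθ.pos p), by simpa using hη.lipschitz.min hθ.lipschitz⟩

theorem IsGauge.div [PseudoMetricSpace P] {η : P → ℝ} (hη : IsGauge η) {c : ℝ} (hc : 1 ≤ c) :
    IsGauge fun p => η p / c := by
  have hc0 : 0 < c := one_pos.trans_le hc
  refine ⟨fun p => div_pos (hη.pos p) hc0, .of_le_add fun p q => ?_⟩
  calc η p / c ≤ (η q + dist p q) / c := by gcongr; exact hη.le_add_dist p q
    _ ≤ η q / c + dist p q := by rw [add_div]; gcongr; exact div_le_self dist_nonneg hc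

/-- The gauge is the distance from the diagonal to the complement of `M`; the case `M = univ` is
separate because `Metric.infDist p ∅ = 0`. -/
theorem exists_isGauge_of_forall_diag_mem [PseudoMetricSpace P] {M : Set (P × P)}
    (hM : IsOpen M) (hdiag : ∀ p, (p, p) ∈ M) :
    ∃ η : P → ℝ, IsGauge η ∧ ∀ p q, dist p q < η p → (p, q) ∈ M := by
  rcases Mᶜ.eq_empty_or_nonempty with hempty | hne
  · exact ⟨_, .const one_pos, fun p q _ => compl_empty_iff.1 hempty ▸ mem_univ _⟩
  refine ⟨fun p => Metric.infDist (p, p) Mᶜ, ⟨fun p => ?_, .of_le_add fun p q => ?_⟩,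
    fun p q hpq => Metric.ball_infDist_compl_subset (x := (p, p)) ?_⟩
  · exact (hM.isClosed_compl.notMem_iff_infDist_pos hne).1 (not_not.2 (hdiag p))
  · simpa [Prod.dist_eq] using (Metric.lipschitz_infDist_pt Mᶜ).le_add_mul (p, p) (q, q)
  · simpa [Prod.dist_eq, dist_comm q p, dist_nonneg.trans_lt hpq] using hpq

theorem limitationNhds_hasBasis_gauge [MetricSpace P] (h : C(Z, P)) :
    (limitationNhds h).HasBasis IsGauge fun η => {k | ∀ z, dist (h z) (k z) < η (h z)} := by
  refine (limitationNhds_hasBasis_diagonal h).to_hasBasis (fun M ⟨hM, hdiag⟩ => ?_)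
    fun η hη => ?_
  · obtain ⟨η, hη, hηM⟩ := exists_isGauge_of_forall_diag_mem hM hdiag
    exact ⟨η, hη, fun k hk z => hηM _ _ (hk z)⟩
  · have hηc := hη.lipschitz.continuous
    refine ⟨{x | dist x.1 x.2 < η x.1}, ⟨isOpen_lt (by fun_prop) (by fun_prop), fun p => ?_⟩,
      Subset.rfl⟩
    simpa using hη.pos p

end LimitationTopology

section ControlledBaire

variable {Z P : Type*} [TopologicalSpace Z]

theorem exists_continuous_limit_of_halving_dist [PseudoMetricSpace P] [CompleteSpace P]
    {h : ℕ → C(Z, P)} {a : ℕ → Z → ℝ} {C : ℝ}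
    (hdist : ∀ n z, dist (h n z) (h (n + 1) z) ≤ a n z)
    (hhalf : ∀ n z, a (n + 1) z ≤ a n z / 2) (hC : ∀ z, a 0 z ≤ C) :
    ∃ H : C(Z, P), (∀ z, Tendsto (fun n => h n z) atTop (𝓝 (H z))) ∧
      ∀ n z, dist (h n z) (H z) ≤ 2 * a n z := by
  have ha : ∀ n z k, a (n + k) z ≤ a n z / 2 ^ k := by
    intro n z k
    induction k with
    | zero => simp
    | succ k ih =>
      rw [pow_succ, ← div_div]
      exact (hhalf (n + k) z).trans (by gcongr)
  have hgeom : ∀ n z k, dist (h (n + k) z) (h (n + k + 1) z) ≤ 2 * a n z / 2 / 2 ^ k := by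
    intro n z k
    rw [mul_div_cancel_left₀ _ two_ne_zero]
    exact (hdist (n + k) z).trans (ha n z k)
  choose H hH using fun z => cauchySeq_tendsto_of_complete
    (cauchySeq_of_le_geometric_two (C := 2 * a 0 z) fun k => by simpa using hgeom 0 z k)
  have hHdist : ∀ n z, dist (h n z) (H z) ≤ 2 * a n z := fun n z =>
    dist_le_of_le_geometric_two_of_tendsto₀ (f := fun k => h (n + k) z) (hgeom n z)
      (by simpa [add_comm] using (tendsto_add_atTop_iff_nat n).2 (hH z))
  have hunif : TendstoUniformly (fun n z => h n z) H atTop := by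
    have hpow : Tendsto (fun n : ℕ => 2 * (C / 2 ^ n)) atTop (𝓝 0) := by
      simpa using (tendsto_const_nhds.div_atTop
        (tendsto_pow_atTop_atTop_of_one_lt (one_lt_two (α := ℝ)))).const_mul 2
    refine Metric.tendstoUniformly_iff.2 fun ε hε => ?_
    filter_upwards [hpow.eventually_lt_const hε] with n hn z
    calc dist (H z) (h n z) ≤ 2 * a n z := dist_comm (H z) _ ▸ hHdist n z
      _ ≤ 2 * (C / 2 ^ n) := by
        have hn0 : a n z ≤ a 0 z / 2 ^ n := by simpa using ha 0 z n
        have := hC z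
        exact mul_le_mul_of_nonneg_left (hn0.trans (by gcongr)) zero_le_two
      _ < ε := hn
  exact ⟨⟨H, hunif.continuous (.of_forall fun n => (h n).continuous)⟩, hH, hHdist⟩

/-- The density condition of the controlled Baire theorem: in every limitation neighbourhood of
every map `h` there are limitation-interior points of `D` whose distance from `h`, measured after
composing with `j`, is at most an arbitrarily small multiple of `lam`. -/
def HasControlledDenseInterior [TopologicalSpace P] {Y : Type*} [PseudoMetricSpace Y]
    (j : C(P, Y)) (lam : Z → ℝ) (D : Set C(Z, P)) : Prop :=
  ∀ ε > 0, ∀ (h : C(Z, P)), ∀ N ∈ limitationNhds h,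
    ∃ h' ∈ N, D ∈ limitationNhds h' ∧ ∀ z, dist (j (h z)) (j (h' z)) ≤ ε * lam z

variable [MetricSpace P] {Y : Type*} [PseudoMetricSpace Y] {j : C(P, Y)} {lam : Z → ℝ}

theorem exists_isGauge_closedBall_subset {h : C(Z, P)} {D : Set C(Z, P)}
    (hD : D ∈ limitationNhds h) {θ : P → ℝ} (hθ : IsGauge θ) :
    ∃ θ' : P → ℝ, IsGauge θ' ∧ (∀ p, θ' p ≤ θ p / 4) ∧
      {k : C(Z, P) | ∀ z, dist (h z) (k z) ≤ 2 * θ' (h z)} ⊆ D := by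
  obtain ⟨η, hη, hηD⟩ := (limitationNhds_hasBasis_gauge h).mem_iff.1 hD
  refine ⟨fun p => min (θ p) (η p) / 4, (hθ.min hη).div (by norm_num), fun p => ?_,
    fun k hk => hηD fun z => (hk z).trans_lt ?_⟩
  · exact div_le_div_of_nonneg_right (min_le_left _ _) zero_le_four
  · linarith [min_le_right (θ (h z)) (η (h z)), hη.pos (h z)]

theorem exists_gauged_seq {D : ℕ → Set C(Z, P)}
    (hD : ∀ n, HasControlledDenseInterior j lam (D n)) (f : C(Z, P)) {θ₀ : P → ℝ}
    (hθ₀ : IsGauge θ₀) :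
    ∃ (h : ℕ → C(Z, P)) (θ : ℕ → P → ℝ), h 0 = f ∧ θ 0 = θ₀ ∧ (∀ n, IsGauge (θ n)) ∧
      (∀ n p, θ (n + 1) p ≤ θ n p / 4) ∧
      (∀ n z, dist (h n z) (h (n + 1) z) < θ n (h n z)) ∧
      (∀ n z, dist (j (h n z)) (j (h (n + 1) z)) ≤ 1 / 4 / 2 ^ n * lam z) ∧
      ∀ n, {k : C(Z, P) | ∀ z, dist (h (n + 1) z) (k z) ≤ 2 * θ (n + 1) (h (n + 1) z)} ⊆ D n := by
  have step : ∀ (n : ℕ) (s : C(Z, P) × {θ : P → ℝ // IsGauge θ}),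
      ∃ s' : C(Z, P) × {θ : P → ℝ // IsGauge θ}, (∀ p, s'.2.1 p ≤ s.2.1 p / 4) ∧
        (∀ z, dist (s.1 z) (s'.1 z) < s.2.1 (s.1 z)) ∧
        (∀ z, dist (j (s.1 z)) (j (s'.1 z)) ≤ 1 / 4 / 2 ^ n * lam z) ∧
        {k : C(Z, P) | ∀ z, dist (s'.1 z) (k z) ≤ 2 * s'.2.1 (s'.1 z)} ⊆ D n := by
    rintro n ⟨h, θ, hθ⟩
    obtain ⟨h', hh', hD', hj⟩ := hD n (1 / 4 / 2 ^ n) (by positivity) h _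
      ((limitationNhds_hasBasis_gauge h).mem_of_mem hθ)
    obtain ⟨θ', hθ', hle, hball⟩ := exists_isGauge_closedBall_subset hD' hθ
    exact ⟨(h', ⟨θ', hθ'⟩), hle, hh', hj, hball⟩
  choose next hle hdist hj hball using step
  let s : ℕ → C(Z, P) × {θ : P → ℝ // IsGauge θ} := fun n => Nat.rec (f, ⟨θ₀, hθ₀⟩) next n
  exact ⟨fun n => (s n).1, fun n => (s n).2.1, rfl, rfl, fun n => (s n).2.2, fun n => hle n (s n),
    fun n => hdist n (s n), fun n => hj n (s n), fun n => hball n (s n)⟩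

theorem exists_mem_iInter_nat_of_hasControlledDenseInterior [CompleteSpace P]
    (hlam : ∀ z, 0 < lam z) {D : ℕ → Set C(Z, P)}
    (hD : ∀ n, HasControlledDenseInterior j lam (D n)) (f : C(Z, P)) {N : Set C(Z, P)}
    (hN : N ∈ limitationNhds f) :
    ∃ h ∈ N, (∀ n, h ∈ D n) ∧ ∀ z, dist (j (f z)) (j (h z)) < lam z := by
  obtain ⟨θ₀, hθ₀, hle₀, hball₀⟩ := exists_isGauge_closedBall_subset hN (.const one_pos)
  obtain ⟨h, θ, rfl, rfl, hθ, hle, hdist, hj, hball⟩ := exists_gauged_seq hD f hθ₀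
  -- `θ (n + 1)` is at most `θ n / 4`, and moving from `h n` to `h (n + 1)` at most doubles `θ n`.
  have hhalf : ∀ n z, θ (n + 1) (h (n + 1) z) ≤ θ n (h n z) / 2 := by
    intro n z
    have hmove : θ n (h (n + 1) z) ≤ θ n (h n z) + dist (h n z) (h (n + 1) z) := by
      simpa [dist_comm] using (hθ n).le_add_dist (h (n + 1) z) (h n z)
    linarith [hle n (h (n + 1) z), hdist n z]
  obtain ⟨H, hlim, hH⟩ := exists_continuous_limit_of_halving_dist
    (a := fun n z => θ n (h n z)) (fun n z => (hdist n z).le) hhalf fun z => hle₀ _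
  refine ⟨H, hball₀ (hH 0), fun n => hball n (hH (n + 1)), fun z => ?_⟩
  calc dist (j (h 0 z)) (j (H z)) ≤ lam z / 2 :=
        dist_le_of_le_geometric_two_of_tendsto₀ (f := fun n => j (h n z))
          (fun n => (hj n z).trans_eq (by ring)) ((j.continuous.tendsto _).comp (hlim z))
    _ < lam z := half_lt_self (hlam z)

theorem exists_mem_iInter_of_hasControlledDenseInterior [CompleteSpace P]
    (hlam : ∀ z, 0 < lam z) {ι : Type*} [Countable ι] {D : ι → Set C(Z, P)}
    (hD : ∀ i, HasControlledDenseInterior j lam (D i)) (f : C(Z, P)) {N : Set C(Z, P)}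
    (hN : N ∈ limitationNhds f) :
    ∃ h ∈ N, (∀ i, h ∈ D i) ∧ ∀ z, dist (j (f z)) (j (h z)) < lam z := by
  rcases isEmpty_or_nonempty ι with _ | _
  · exact ⟨f, @mem_of_mem_nhds _ (limitationTopology Z P) _ _ hN, isEmptyElim,
      fun z => by simpa using hlam z⟩
  · obtain ⟨i, hi⟩ := exists_surjective_nat ι
    obtain ⟨h, hhN, hhD, hj⟩ :=
      exists_mem_iInter_nat_of_hasControlledDenseInterior hlam (fun n => hD (i n)) f hN
    exact ⟨h, hhN, hi.forall.2 hhD, hj⟩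

end ControlledBaire

section BanachExtension

variable {Z B E : Type*} [TopologicalSpace Z] [NormalSpace Z] [ParacompactSpace Z]
  [TopologicalSpace B] [NormedAddCommGroup E] [NormedSpace ℝ E] {e : C(B, Z)}

theorem exists_approx_extension_mem_convex (he : IsClosedEmbedding e) {C : Set E}
    (hC : Convex ℝ C) (hne : C.Nonempty) {g : C(B, E)} (hg : ∀ b, g b ∈ C) {ε : ℝ} (hε : 0 < ε) :
    ∃ F : C(Z, E), (∀ z, F z ∈ C) ∧ ∀ b, dist (F (e b)) (g b) ≤ ε := by
  let t : Z → Set E := fun z => C ∩ ⋂ (b : B) (_ : e b = z), Metric.closedBall (g b) ε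
  have ht : ∀ z, Convex ℝ (t z) := fun z =>
    hC.inter (convex_iInter fun b => convex_iInter fun _ => convex_closedBall _ _)
  have hloc : ∀ z, ∃ c, ∀ᶠ y in 𝓝 z, c ∈ t y := by
    intro z
    by_cases hz : z ∈ range e
    · obtain ⟨b, rfl⟩ := hz
      have hnear : ∀ᶠ b' in 𝓝 b, g b ∈ Metric.closedBall (g b') ε := by
        filter_upwards [g.continuous.continuousAt.eventually (Metric.closedBall_mem_nhds _ hε)]
          with b' hb'
        exact Metric.mem_closedBall_comm.1 hb'
      rw [he.isEmbedding.nhds_eq_comap, eventually_comap] at hnear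
      exact ⟨g b, hnear.mono fun y hy => ⟨hg b, mem_iInter₂.2 hy⟩⟩
    · obtain ⟨c, hc⟩ := hne
      refine ⟨c, ?_⟩
      filter_upwards [he.isClosed_range.isOpen_compl.mem_nhds hz] with y hy
      exact ⟨hc, mem_iInter₂.2 fun b hb => (hy ⟨b, hb⟩).elim⟩
  obtain ⟨F, hF⟩ := exists_continuous_forall_mem_convex_of_local_const ht hloc
  exact ⟨F, fun z => (hF z).1, fun b => mem_iInter₂.1 (hF (e b)).2 b rfl⟩

theorem exists_extension_halving_error (he : IsClosedEmbedding e) {g : C(B, E)} {F : C(Z, E)}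
    {c : ℝ} (hc : 0 < c) (hF : ∀ b, dist (F (e b)) (g b) ≤ c) :
    ∃ F' : C(Z, E), (∀ z, dist (F z) (F' z) ≤ c) ∧ ∀ b, dist (F' (e b)) (g b) ≤ c / 2 := by
  obtain ⟨φ, hφ, hφg⟩ := exists_approx_extension_mem_convex he
    (convex_closedBall (0 : E) c) ⟨0, Metric.mem_closedBall_self hc.le⟩ (g := g - F.comp e)
    (fun b => by simpa [dist_eq_norm, norm_sub_rev] using hF b) (half_pos hc)
  refine ⟨F + φ, fun z => by simpa using hφ z, fun b => ?_⟩
  have hsub : F (e b) + φ (e b) - g b = φ (e b) - (g b - F (e b)) := by abel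
  simpa [dist_eq_norm, hsub] using hφg b

theorem exists_extension_of_isClosedEmbedding [CompleteSpace E] (he : IsClosedEmbedding e)
    (g : C(B, E)) : ∃ F : C(Z, E), ∀ b, F (e b) = g b := by
  let Approx (n : ℕ) := {F : C(Z, E) // ∀ b, dist (F (e b)) (g b) ≤ (1 / 2) ^ n}
  have step : ∀ (n : ℕ) (F : Approx n), ∃ F' : Approx (n + 1),
      ∀ z, dist (F.1 z) (F'.1 z) ≤ (1 / 2) ^ n := by
    rintro n ⟨F, hF⟩
    obtain ⟨F', hFF', hF'⟩ := exists_extension_halving_error he (by positivity) hF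
    exact ⟨⟨F', fun b => (hF' b).trans_eq (by ring)⟩, hFF'⟩
  choose next hnext using step
  obtain ⟨F₀, -, hF₀⟩ := exists_approx_extension_mem_convex he convex_univ univ_nonempty
    (fun b => mem_univ (g b)) one_pos
  let F : ∀ n, Approx n := fun n => Nat.rec ⟨F₀, by simpa using hF₀⟩ next n
  obtain ⟨H, hlim, -⟩ := exists_continuous_limit_of_halving_dist (h := fun n => (F n).1)
    (a := fun n _ => (1 / 2) ^ n) (C := 1) (fun n => hnext n (F n))
    (fun n _ => le_of_eq (by ring)) fun _ => by simp
  refine ⟨H, fun b => tendsto_nhds_unique (hlim (e b)) ?_⟩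
  exact tendsto_iff_dist_tendsto_zero.2 <| squeeze_zero (fun _ => dist_nonneg)
    (fun n => (F n).2 b) (tendsto_pow_atTop_nhds_zero_of_lt_one (by norm_num) (by norm_num))

end BanachExtension

section StraightLineMoves

variable {Z E : Type*} [TopologicalSpace Z] [NormedAddCommGroup E] [NormedSpace ℝ E]

theorem isOpen_setOf_forall_lineMap_mem {T : Set (Z × E)} (hT : IsOpen T) (F₀ F₁ : C(Z, E)) :
    IsOpen {z | ∀ t ∈ Icc (0 : ℝ) 1, (z, AffineMap.lineMap (F₀ z) (F₁ z) t) ∈ T} := by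
  have hline : Continuous fun y : Z × ℝ => (y.1, AffineMap.lineMap (F₀ y.1) (F₁ y.1) y.2) := by
    simp only [AffineMap.lineMap_apply_module']
    fun_prop
  exact isOpen_iff_eventually.2 fun z hz =>
    isCompact_Icc.eventually_forall_of_forall_eventually fun t ht =>
      hline.continuousAt.eventually (hT.mem_nhds (hz t ht))

/-- Move along the straight lines from `F₀` to `F₁`, slowed down by a Urysohn function. -/
theorem exists_eqOn_of_forall_lineMap_mem [NormalSpace Z] {K W : Set Z} (hK : IsClosed K)
    (hW : IsOpen W) (hKW : K ⊆ W) {T : Set (Z × E)} (hT : IsOpen T) {F₀ F₁ : C(Z, E)}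
    (hF₀ : ∀ z, (z, F₀ z) ∈ T)
    (hline : ∀ z ∈ K, ∀ t ∈ Icc (0 : ℝ) 1, (z, AffineMap.lineMap (F₀ z) (F₁ z) t) ∈ T) :
    ∃ F : C(Z, E), EqOn F F₁ K ∧ EqOn F F₀ Wᶜ ∧ ∀ z, (z, F z) ∈ T := by
  let S := W ∩ {z | ∀ t ∈ Icc (0 : ℝ) 1, (z, AffineMap.lineMap (F₀ z) (F₁ z) t) ∈ T}
  have hS : IsOpen S := hW.inter (isOpen_setOf_forall_lineMap_mem hT F₀ F₁)
  have hSK : Disjoint Sᶜ K := disjoint_compl_left_iff_subset.2 fun z hz => ⟨hKW hz, hline z hz⟩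
  obtain ⟨τ, hτ0, hτ1, hτ⟩ := exists_continuous_zero_one_of_isClosed hS.isClosed_compl hK hSK
  refine ⟨⟨fun z => AffineMap.lineMap (F₀ z) (F₁ z) (τ z), ?_⟩, fun z hz => ?_, fun z hz => ?_,
    fun z => ?_⟩
  · simp only [AffineMap.lineMap_apply_module']
    fun_prop
  · simp [hτ1 hz]
  · simp [hτ0 fun hzS => hz hzS.1]
  · by_cases hz : z ∈ S
    · exact hz.2 _ (hτ z)
    · simpa [hτ0 hz] using hF₀ z

end StraightLineMoves

section ANR

open scoped BoundedContinuousFunction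

/-- Kuratowski's embedding `p ↦ dist · p - dist · p₀`. -/
theorem exists_isometry_boundedContinuousFunction (P : Type*) [PseudoMetricSpace P] :
    ∃ φ : P → P →ᵇ ℝ, Isometry φ := by
  rcases isEmpty_or_nonempty P with _ | ⟨⟨p₀⟩⟩
  · exact ⟨isEmptyElim, fun p => isEmptyElim p⟩
  have hbound : ∀ p x, ‖dist x p - dist x p₀‖ ≤ dist p p₀ := fun p x => by
    simpa only [dist_comm x, Real.dist_eq, Real.norm_eq_abs] using dist_dist_dist_le_left p p₀ x
  let φ : P → P →ᵇ ℝ := fun p => .ofNormedAddCommGroup (fun x => dist x p - dist x p₀)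
    (by fun_prop) (dist p p₀) (hbound p)
  have hφ : ∀ p q x, dist (φ p x) (φ q x) = dist (dist x p) (dist x q) := fun p q x =>
    dist_sub_right _ _ _
  refine ⟨φ, .of_dist_eq fun p q => le_antisymm ?_ ?_⟩
  · refine (BoundedContinuousFunction.dist_le dist_nonneg).2 fun x => ?_
    rw [hφ, dist_comm x, dist_comm x]
    exact dist_dist_dist_le_left p q x
  · calc dist p q = dist (φ p q) (φ q q) := by simp [hφ, dist_comm q p]
      _ ≤ dist (φ p) (φ q) := BoundedContinuousFunction.dist_coe_le_dist q

theorem IsANR.exists_neighborhood_retraction {P : Type*} [MetricSpace P] [CompleteSpace P]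
    (hP : IsANR P) : ∃ (φ : C(P, P →ᵇ ℝ)) (U : Set (P →ᵇ ℝ)) (r : C(U, P)), IsOpen U ∧
      ∀ p, ∃ hp : φ p ∈ U, r ⟨φ p, hp⟩ = p := by
  obtain ⟨φ, hφ⟩ := exists_isometry_boundedContinuousFunction P
  obtain ⟨U, hU, hφU, r, hr⟩ := hP.2 _ φ hφ.isClosedEmbedding
  exact ⟨⟨φ, hφ.continuous⟩, U, r, hU,
    fun p => ⟨hφU (mem_range_self p), hr p (hφU (mem_range_self p))⟩⟩

theorem isOpen_setOf_exists_mem_of_isOpen {P Q E : Type*} [TopologicalSpace P]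
    [TopologicalSpace Q] [TopologicalSpace E] {U : Set E} (hU : IsOpen U) (r : C(U, P))
    {M : Set (Q × P)} (hM : IsOpen M) :
    IsOpen {x : Q × E | ∃ hx : x.2 ∈ U, (x.1, r ⟨x.2, hx⟩) ∈ M} := by
  have himage := (IsOpenEmbedding.id.prodMap hU.isOpenEmbedding_subtypeVal).isOpenMap _
    (hM.preimage (by fun_prop : Continuous fun x : Q × U => (x.1, r x.2)))
  convert himage using 1
  ext ⟨q, v⟩
  simp [and_comm]

variable {P : Type*} [MetricSpace P] [CompleteSpace P] {Z B : Type*} [TopologicalSpace Z]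
  [NormalSpace Z] [ParacompactSpace Z] [TopologicalSpace B] {e : C(B, Z)}

theorem IsANR.eventually_exists_extension (hP : IsANR P) (he : IsClosedEmbedding e)
    (h : C(Z, P)) {N : Set C(Z, P)} (hN : N ∈ limitationNhds h) {W : Set Z} (hW : IsOpen W)
    (heW : range e ⊆ W) :
    ∀ᶠ g in limitationNhds (h.comp e), ∃ h' ∈ N, h'.comp e = g ∧ EqOn h' h Wᶜ := by
  obtain ⟨M, ⟨hM, hdiag⟩, hMN⟩ := (limitationNhds_hasBasis_diagonal h).mem_iff.1 hN
  obtain ⟨φ, U, r, hU, hr⟩ := hP.exists_neighborhood_retraction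
  choose hφU hrφ using hr
  let T : Set (P × (P →ᵇ ℝ)) := {x | ∃ hx : x.2 ∈ U, (x.1, r ⟨x.2, hx⟩) ∈ M}
  have hT : IsOpen T := isOpen_setOf_exists_mem_of_isOpen hU r hM
  have hφT : ∀ p, (p, φ p) ∈ T := fun p => ⟨hφU p, by simpa [hrφ] using hdiag p⟩
  let M' : Set (P × P) :=
    {x | ∀ t ∈ Icc (0 : ℝ) 1, (x.1, AffineMap.lineMap (φ x.1) (φ x.2) t) ∈ T}
  have hM' : IsOpen M' :=
    isOpen_setOf_forall_lineMap_mem (T := {y : (P × P) × (P →ᵇ ℝ) | (y.1.1, y.2) ∈ T})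
      (hT.preimage (by fun_prop)) (φ.comp .fst) (φ.comp .snd)
  have hdiag' : ∀ p, (p, p) ∈ M' := fun p t _ => by simpa using hφT p
  filter_upwards [(limitationNhds_hasBasis_diagonal _).mem_of_mem ⟨hM', hdiag'⟩] with g hg
  obtain ⟨F₁, hF₁⟩ := exists_extension_of_isClosedEmbedding he (φ.comp g)
  obtain ⟨F, hFK, hFW, hFT⟩ := exists_eqOn_of_forall_lineMap_mem he.isClosed_range hW heW
    (T := {y : Z × (P →ᵇ ℝ) | (h y.1, y.2) ∈ T}) (hT.preimage (by fun_prop)) (F₀ := φ.comp h)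
    (F₁ := F₁) (fun z => hφT (h z)) (by rintro _ ⟨b, rfl⟩ t ht; simpa [hF₁] using hg b t ht)
  choose hFU hFM using hFT
  refine ⟨⟨fun z => r ⟨F z, hFU z⟩, by fun_prop⟩, hMN hFM, ?_, fun z hz => ?_⟩
  · ext b
    simp [hFK (mem_range_self b), hF₁, hrφ]
  · simp [hFW hz, hrφ]

theorem IsANR.hasControlledDenseInterior_comp (hP : IsANR P) {Y : Type*} [PseudoMetricSpace Y]
    (j : C(P, Y)) {lam : C(Z, ℝ)} (hlam : ∀ z, 0 ≤ lam z) (he : IsClosedEmbedding e)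
    (hinf : ∃ c > 0, ∀ b, c ≤ lam (e b)) {O : Set C(B, P)}
    (hO : IsOpen[limitationTopology B P] O) (hOd : @Dense _ (limitationTopology B P) O) :
    HasControlledDenseInterior j lam {k : C(Z, P) | k.comp e ∈ O} := by
  intro ε hε h N hN
  obtain ⟨c, hc, hce⟩ := hinf
  have hclose : {k : C(Z, P) | ∀ z, dist (j (h z)) (j (k z)) < ε * (c / 2)} ∈
      limitationNhds h := by
    refine (limitationNhds_hasBasis_diagonal h).mem_of_mem
      (i := {x | dist (j x.1) (j x.2) < ε * (c / 2)})
      ⟨isOpen_lt (by fun_prop) continuous_const, fun p => ?_⟩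
    simpa using by positivity
  have hextend := hP.eventually_exists_extension he h (inter_mem hN hclose)
    (W := {z | c / 2 < lam z}) (isOpen_lt continuous_const lam.continuous)
    (by rintro _ ⟨b, rfl⟩; exact (half_lt_self hc).trans_le (hce b))
  obtain ⟨_, hgO, h', ⟨hh'N, hh'j⟩, rfl, hh'W⟩ :=
    ((@mem_closure_iff_frequently _ (limitationTopology B P) _ _).1 (hOd (h.comp e))
      |>.and_eventually hextend).exists
  have hopen := @IsOpen.preimage _ _ (limitationTopology Z P) (limitationTopology B P) _
    (continuous_comp_limitationTopology e) _ hO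
  refine ⟨h', hh'N, @IsOpen.mem_nhds _ (limitationTopology Z P) _ _ hopen hgO, fun z => ?_⟩
  by_cases hz : c / 2 < lam z
  · exact (hh'j z).le.trans (by gcongr)
  · simpa [hh'W hz] using mul_nonneg hε.le (hlam z)

end ANR

theorem IsANR.exists_near_comp_mem_of_isGδ {P : Type*} [TopologicalSpace P]
    [TopologicalSpace.IsCompletelyMetrizableSpace P] (hP : IsANR P) {Y : Type*}
    [PseudoMetricSpace Y] (j : C(P, Y)) {Z : Type*} [TopologicalSpace Z] [NormalSpace Z]
    [ParacompactSpace Z] {lam : C(Z, ℝ)} (hlam : ∀ z, 0 < lam z) {ι : Type*} [Countable ι]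
    {B : ι → Type*} [∀ i, TopologicalSpace (B i)] {e : ∀ i, C(B i, Z)}
    (he : ∀ i, IsClosedEmbedding (e i)) (hinf : ∀ i, ∃ c > 0, ∀ b, c ≤ lam (e i b))
    {G : ∀ i, Set C(B i, P)} (hGd : ∀ i, @Dense _ (limitationTopology (B i) P) (G i))
    (hG : ∀ i, @IsGδ _ (limitationTopology (B i) P) (G i)) (f : C(Z, P)) {N : Set C(Z, P)}
    (hN : N ∈ limitationNhds f) :
    ∃ h ∈ N, (∀ i, h.comp (e i) ∈ G i) ∧ ∀ z, dist (j (f z)) (j (h z)) < lam z := by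
  let _ := TopologicalSpace.upgradeIsCompletelyMetrizable P
  choose O hO hGO using fun i =>
    (@isGδ_iff_eq_iInter_nat _ (limitationTopology (B i) P) _).1 (hG i)
  have hOd : ∀ i n, @Dense _ (limitationTopology (B i) P) (O i n) := fun i n =>
    @Dense.mono _ (limitationTopology (B i) P) _ _ (hGO i ▸ iInter_subset _ n) (hGd i)
  obtain ⟨h, hhN, hhO, hj⟩ := exists_mem_iInter_of_hasControlledDenseInterior hlam
    (fun i : ι × ℕ => hP.hasControlledDenseInterior_comp j (fun z => (hlam z).le) (he i.1)
      (hinf i.1) (hO i.1 i.2) (hOd i.1 i.2)) f hN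
  exact ⟨h, hhN, fun i => hGO i ▸ mem_iInter.2 fun n => hhO (i, n), hj⟩

theorem exists_continuous_zeroSet_forall_pos_le {X : Type*} [TopologicalSpace X]
    [PerfectlyNormalSpace X] {A : Set X} (hA : IsClosed A) {ι : Type*} [Countable ι]
    {F : ι → Set X} (hF : ∀ i, IsClosed (F i)) (hAF : ∀ i, Disjoint A (F i)) :
    ∃ μ : C(X, ℝ), (∀ x ∈ A, μ x = 0) ∧ (∀ x ∉ A, 0 < μ x) ∧
      ∀ i, ∃ c > 0, ∀ x ∈ F i, c ≤ μ x := by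
  obtain ⟨w, rfl, hw⟩ := perfectlyNormalSpace_iff_forall_isClosed_preimage_zero.1 ‹_› A hA
  choose u hu0 hu1 hu using fun i => exists_continuous_zero_one_of_isClosed hA (hF i) (hAF i)
  have _ := Encodable.ofCountable ι
  obtain ⟨δ, hδ, _, hδsum, -⟩ := posSumOfEncodable one_pos ι
  have hnonneg : ∀ i x, 0 ≤ δ i * u i x := fun i x => mul_nonneg (hδ i).le (hu i x).1
  have hle : ∀ i x, δ i * u i x ≤ δ i := fun i x => mul_le_of_le_one_right (hδ i).le (hu i x).2
  have hsum : ∀ x, Summable fun i => δ i * u i x := fun x =>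
    .of_nonneg_of_le (fun i => hnonneg i x) (fun i => hle i x) hδsum.summable
  have hcont : Continuous fun x => ∑' i, δ i * u i x :=
    continuous_tsum (fun i => by fun_prop) hδsum.summable fun i x => by
      simpa only [Real.norm_of_nonneg (hnonneg i x)] using hle i x
  refine ⟨w + ⟨_, hcont⟩, fun x hx => ?_, fun x hx => ?_, fun i => ⟨δ i, hδ i, fun x hx => ?_⟩⟩
  · have hux : ∀ i, u i x = 0 := fun i => hu0 i hx
    simpa [hux] using hx
  · exact add_pos_of_pos_of_nonneg ((hw x).1.lt_of_ne' hx) (tsum_nonneg fun i => hnonneg i x)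
  · calc δ i = δ i * u i x := by simp [hu1 i hx]
      _ ≤ ∑' i, δ i * u i x := (hsum x).le_tsum i fun k _ => hnonneg k x
      _ ≤ w x + ∑' i, δ i * u i x := le_add_of_nonneg_left (hw x).1

theorem exists_continuousMap_eqOn_of_dist_le {X Y : Type*} [TopologicalSpace X]
    [PseudoMetricSpace Y] {A : Set X} (hA : IsClosed A) (f : C(X, Y)) (g : C((Aᶜ : Set X), Y))
    {μ : C(X, ℝ)} (hμ : ∀ x ∈ A, μ x = 0)
    (hfg : ∀ x : (Aᶜ : Set X), dist (f x) (g x) ≤ μ x) :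
    ∃ h : C(X, Y), EqOn h f A ∧ ∀ x : (Aᶜ : Set X), h x = g x := by
  classical
  let h : X → Y := fun x => if hx : x ∈ A then f x else g ⟨x, hx⟩
  have hhf : ∀ x ∈ A, h x = f x := fun x hx => dif_pos hx
  have hhg : ∀ x : (Aᶜ : Set X), h x = g x := fun x => dif_neg x.2
  have hdist : ∀ x, dist (h x) (f x) ≤ μ x := by
    intro x
    by_cases hx : x ∈ A
    · rw [hhf x hx, dist_self, hμ x hx]
    · rw [hhg ⟨x, hx⟩, dist_comm]
      exact hfg ⟨x, hx⟩
  refine ⟨⟨h, continuous_iff_continuousAt.2 fun x => ?_⟩, hhf, hhg⟩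
  by_cases hx : x ∈ A
  · rw [ContinuousAt, hhf x hx, tendsto_iff_dist_tendsto_zero]
    have hzero : Tendsto (fun y => μ y + dist (f y) (f x)) (𝓝 x) (𝓝 0) := by
      have hcont : Continuous fun y => μ y + dist (f y) (f x) := by fun_prop
      simpa [hμ x hx] using hcont.tendsto x
    exact squeeze_zero (fun _ => dist_nonneg)
      (fun y => (dist_triangle _ (f y) _).trans (by gcongr; exact hdist y)) hzero
  · have hcont : ContinuousOn h Aᶜ := continuousOn_iff_continuous_domRestrict.2
      (g.continuous.congr fun y => (hhg y).symm)
    exact hcont.continuousAt (hA.isOpen_compl.mem_nhds hx)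

theorem mainTheorem8_general {X : Type*} [TopologicalSpace X] [PerfectlyNormalSpace X]
    {Y : Type*} [PseudoMetricSpace Y]
    (P : Set Y) [TopologicalSpace.IsCompletelyMetrizableSpace P] (hP : IsANR P)
    {A : Set X} (hA : IsClosed A) [ParacompactSpace (Aᶜ : Set X)]
    {ι : Type*} [Countable ι] {K : ι → Set X} (hK : ∀ i, IsClosed (K i)) (hKA : ∀ i, K i ⊆ Aᶜ)
    {D : ∀ i, Set C(K i, P)} (hDd : ∀ i, @Dense _ (limitationTopology (K i) P) (D i))
    (hD : ∀ i, @IsGδ _ (limitationTopology (K i) P) (D i))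
    (lam : C((Aᶜ : Set X), ℝ)) (hlam : ∀ x, 0 < lam x)
    (hinf : ∀ i, ∃ c > 0, ∀ x : K i, c ≤ lam ⟨x, hKA i x.2⟩)
    (f : C(X, Y)) (hf : MapsTo f Aᶜ P)
    {G : Set C((Aᶜ : Set X), P)} (hG : G ∈ limitationNhds (restrictTo f Aᶜ P hf)) :
    ∃ h : C(X, Y), EqOn h f A ∧ ∃ hhP : MapsTo h Aᶜ P,
      (∀ i, restrictTo h (K i) P (hhP.mono_left (hKA i)) ∈ D i) ∧
      restrictTo h Aᶜ P hhP ∈ G ∧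
      ∀ x : (Aᶜ : Set X), dist (h x) (f x) < lam x := by
  obtain ⟨μ, hμA, hμ, hμK⟩ := exists_continuous_zeroSet_forall_pos_le hA hK fun i =>
    disjoint_compl_right.mono_right (hKA i)
  let ν : C((Aᶜ : Set X), ℝ) := ⟨fun x => min (lam x) (μ x), by fun_prop⟩
  have hν : ∀ i, ∃ c > 0, ∀ x : K i, c ≤ ν ⟨x, hKA i x.2⟩ := fun i => by
    obtain ⟨c, hc, hcl⟩ := hinf i
    obtain ⟨d, hd, hdμ⟩ := hμK i
    exact ⟨min c d, lt_min hc hd, fun x => min_le_min (hcl x) (hdμ x x.2)⟩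
  let e : ∀ i, C(K i, (Aᶜ : Set X)) := fun i => ⟨inclusion (hKA i), continuous_inclusion _⟩
  have he : ∀ i, IsClosedEmbedding (e i) := fun i =>
    ⟨.inclusion (hKA i), range_inclusion (hKA i) ▸ (hK i).preimage continuous_subtype_val⟩
  let val : C(P, Y) := ⟨Subtype.val, continuous_subtype_val⟩
  obtain ⟨H, hHG, hHD, hHf⟩ := hP.exists_near_comp_mem_of_isGδ val (lam := ν)
    (fun x => lt_min (hlam x) (hμ x x.2)) he hν hDd hD (restrictTo f Aᶜ P hf) hG
  obtain ⟨h, hhf, hhH⟩ := exists_continuousMap_eqOn_of_dist_le hA f (val.comp H) hμA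
    fun x => (hHf x).le.trans (min_le_right _ _)
  have hhP : MapsTo h Aᶜ P := fun x hx => hhH ⟨x, hx⟩ ▸ (H ⟨x, hx⟩).2
  have hrestrict : restrictTo h Aᶜ P hhP = H := by
    ext x
    exact hhH x
  refine ⟨h, hhf, hhP, fun i => ?_, hrestrict ▸ hHG, fun x => ?_⟩
  · have hcomp := hHD i
    rwa [← hrestrict] at hcomp
  · rw [hhH x, dist_comm]
    exact (hHf x).trans_le (min_le_left _ _)

theorem mainTheorem8 {X : Type u} [TopologicalSpace X] [TopologicalSpace.MetrizableSpace X]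
    {Y : Type v} [MetricSpace Y]
    (P : Set Y) (hPcm : TopologicalSpace.IsCompletelyMetrizableSpace P) (hPanr : IsANR P)
    (A : Set X) (hA : IsClosed A)
    (An : ℕ → Set X) (hAn : ∀ n, IsClosed (An n)) (hAne : ∀ n, (An n).Nonempty)
    (hdisj : ∀ n, An n ⊆ Aᶜ)
    (Gn : ∀ n, Set C(An n, P))
    (hGdense : ∀ n, @Dense _ (limitationTopology (An n) P) (Gn n))
    (hGdelta : ∀ n, @IsGδ _ (limitationTopology (An n) P) (Gn n))
    (lam : C((Aᶜ : Set X), ℝ)) (hlam : ∀ x, 0 < lam x)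
    (hinf : ∀ n, 0 < ⨅ x : An n, lam ⟨x, hdisj n x.2⟩)
    (f : C(X, Y)) (hf : MapsTo f Aᶜ P)
    (G : Set C((Aᶜ : Set X), P))
    (hG : G ∈ @nhds _ (limitationTopology (Aᶜ : Set X) P) (restrictTo f Aᶜ P hf)) :
    ∃ h : C(X, Y), EqOn h f A ∧ ∃ hP : MapsTo h Aᶜ P,
      (∀ n, restrictTo h (An n) P (hP.mono_left (hdisj n)) ∈ Gn n) ∧
      restrictTo h Aᶜ P hP ∈ G ∧
      ∀ x : (Aᶜ : Set X), dist (h x) (f x) < lam x := by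
  let _ := TopologicalSpace.metrizableSpaceMetric X
  exact mainTheorem8_general P hPanr hA hAn hdisj hGdense hGdelta lam hlam
    (fun n => ⟨_, hinf n, ciInf_le ⟨0, forall_mem_range.2 fun x => (hlam _).le⟩⟩) f hf hG
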